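/- Let $k\ge 1$. A germ of regular $k$-web $\mathcal W=\mathcal F_1\boxtimes\cdots\boxtimes\mathcal F_k$ on $(\mathbb C^2,0)$ is a collection of $k$ germs of smooth holomorphic foliations, $\mathcal F_i$ being induced by a germ of holomorphic $1$-form $\omega_i$ with $\omega_i(0)\neq 0$, such that any two of them have distinct tangent spaces $\ker\omega_i(0)$ at the origin. Its space of abelian relations is the complex vector space $$\mathcal A(\mathcal W)=\Big\{(\eta_i)_{i=1}^k\in(\Omega^1(\mathbb C^2,0))^k \ \Big|\ d\eta_i=0,\ \eta_i\wedge\omega_i=0 \text{ for all } i,\ \text{ and } \sum_{i=1}^k\eta_i=0\Big\},$$ where $\Omega^1(\mathbb C^2,0)$ is the space of germs at $0$ of holomorphic $1$-forms. Its dimension is the rank $\mathrm{rk}(\mathcal W)$, and $\mathcal W$ is said to have maximal rank if $\mathrm{rk}(\mathcal W)=\tfrac12(k-1)(k-2)$. Let $X$ be a germ of holomorphic vector field on $(\mathbb C^2,0)$ which is an infinitesimal automorphism of $\mathcal W$, i.e. $L_X\omega_i\wedge\omega_i=0$ for every $i$, where $L_X=i_Xd+d\,i_X$ (the local flow of $X$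 preserves each $\mathcal F_i$). Assume that $X$ is regular and transverse to $\mathcal W$, i.e. $X(0)\ne 0$ and $\omega_i(X)(0)\neq 0$ for every $i$, and let $\mathcal F_X$ be the foliation by trajectories of $X$, induced by $i_X(dx\wedge dy)$; thus $\mathcal W\boxtimes\mathcal F_X$ is a germ of regular $(k+1)$-web. Then $\mathcal A(\mathcal W)$ and $\mathcal A(\mathcal W\boxtimes\mathcal F_X)$ are finite-dimensional and $$\mathrm{rk}(\mathcal W\boxtimes\mathcal F_X)=\mathrm{rk}(\mathcal W)+(k-1).$$ In particular, $\mathcal W$ has maximal rank if and only if $\mathcal W\boxtimes\mathcal F_X$ has maximal rank. -/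

import Mathlib

open Filter Topology

noncomputable section

namespace PlanarWeb

/-- The complex plane `ℂ²`; germs are taken at its origin `0`. -/
abbrev Plane : Type := ℂ × ℂ

/-- Differential `1`-forms on `ℂ²` (no regularity imposed here). -/
abbrev OneForm : Type := Plane → Plane →L[ℂ] ℂ

/-- The wedge product of two covectors, as a bilinear form:
`(α ∧ β)(v, w) = α v * β w - β v * α w`. -/
def wedge (α β : Plane →L[ℂ] ℂ) : Plane →L[ℂ] Plane →L[ℂ] ℂ :=
  α.smulRight β - β.smulRight α

theorem wedge_apply (α β : Plane →L[ℂ] ℂ) (v w : Plane) :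
    wedge α β v w = α v * β w - β v * α w := by
  simp [wedge]

/-- The exterior derivative of a `1`-form at a point, as a bilinear form:
`dη_z(v, w) = (D_v η)(w) - (D_w η)(v)`. -/
def extD (η : OneForm) (z : Plane) : Plane →L[ℂ] Plane →L[ℂ] ℂ :=
  fderiv ℂ η z - (fderiv ℂ η z).flip

theorem extD_apply (η : OneForm) (z v w : Plane) :
    extD η z v w = fderiv ℂ η z v w - fderiv ℂ η z w v := by
  simp [extD]

/-- `extD` is Mathlib's exterior derivative of differential forms, for `1`-forms. -/
theorem extD_eq_extDeriv (η : OneForm) (z v w : Plane) (h : DifferentiableAt ℂ η z) :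
    extD η z v w =
      extDeriv (fun x => ContinuousAlternatingMap.ofSubsingleton ℂ Plane ℂ (0 : Fin 1) (η x)) z
        ![v, w] := by
  have e : (fun x => ContinuousAlternatingMap.ofSubsingleton ℂ Plane ℂ (0 : Fin 1) (η x)) =
      ContinuousAlternatingMap.ofSubsingletonLIE (𝕜 := ℂ) (E := Plane) (F := ℂ) (0 : Fin 1) ∘ η := rfl
  have h' : DifferentiableAt ℂ
      (fun x => ContinuousAlternatingMap.ofSubsingleton ℂ Plane ℂ (0 : Fin 1) (η x)) z := by
    rw [e]
    exact (LinearIsometryEquiv.differentiableAt _).comp z h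
  have hd (u : Plane) : fderiv ℂ (fun x => η x u) z = (fderiv ℂ η z).flip u := by
    ext <;> simp [fderiv_clm_apply h (differentiableAt_const u)]
  rw [extDeriv_apply h']
  simp [Fin.sum_univ_two, Fin.removeNth, hd, extD_apply, sub_eq_add_neg]

/-- A germ of smooth holomorphic foliation on `(ℂ², 0)`, given by a germ of holomorphic `1`-form
inducing it, which does not vanish at the origin. -/
structure FoliationGerm where
  /-- a `1`-form inducing the foliation -/
  form : OneForm
  analyticAt : AnalyticAt ℂ form 0
  form_zero_ne : form 0 ≠ 0

/-- The tangent space of the foliation at the point `z`: the kernel of the inducing form. -/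
def FoliationGerm.tangentSpace (F : FoliationGerm) (z : Plane) : Submodule ℂ Plane :=
  LinearMap.ker (F.form z).toLinearMap

/-- A germ of regular `k`-web on `(ℂ², 0)`: `k` germs of smooth foliations with pairwise distinct
tangent spaces at the origin. -/
structure Web (k : ℕ) where
  /-- the foliations of the web -/
  fol : Fin k → FoliationGerm
  distinct : Pairwise fun i j => (fol i).tangentSpace 0 ≠ (fol j).tangentSpace 0

/-- The `(k+1)`-web `W ⊠ F`, for a foliation `F` whose tangent space at the origin is distinct
from those of the foliations of `W`. -/
def Web.superpose {k : ℕ} (W : Web k) (F : FoliationGerm)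
    (h : ∀ i, (W.fol i).tangentSpace 0 ≠ F.tangentSpace 0) : Web (k + 1) where
  fol := Fin.snoc (α := fun _ => FoliationGerm) W.fol F
  distinct := by
    intro i j hij
    induction i using Fin.lastCases with
    | last =>
      induction j using Fin.lastCases with
      | last => exact absurd rfl hij
      | cast j => simpa using (h j).symm
    | cast i =>
      induction j using Fin.lastCases with
      | last => simpa using h i
      | cast j => simpa using W.distinct fun e => hij (by rw [e])

/-- The space of abelian relations of `W`, inside the space of `k`-tuples of germs at the origin
of `1`-forms: tuples of germs of holomorphic `1`-forms `η_i` such that `d η_i = 0`,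
`η_i ∧ ω_i = 0` and `∑ η_i = 0`, where `ω_i` induces the `i`-th foliation of `W`. -/
def Web.abelianRelations {k : ℕ} (W : Web k) :
    Submodule ℂ (Fin k → Germ (𝓝 (0 : Plane)) (Plane →L[ℂ] ℂ)) where
  carrier := {g | (∀ i, ∃ η : OneForm, (η : Germ (𝓝 (0 : Plane)) (Plane →L[ℂ] ℂ)) = g i ∧
      AnalyticAt ℂ η 0 ∧ (∀ᶠ z in 𝓝 0, extD η z = 0) ∧
      ∀ᶠ z in 𝓝 0, wedge (η z) ((W.fol i).form z) = 0) ∧ ∑ i, g i = 0}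
  zero_mem' := by
    refine ⟨fun i => ⟨0, rfl, analyticAt_const, ?_, ?_⟩, by simp⟩
    · exact .of_forall fun z => by ext <;> simp [extD]
    · exact .of_forall fun z => by ext <;> simp [wedge]
  add_mem' := by
    rintro a b ⟨ha, ha'⟩ ⟨hb, hb'⟩
    refine ⟨fun i => ?_, by simp [Finset.sum_add_distrib, ha', hb']⟩
    obtain ⟨η, h1, h2, h3, h4⟩ := ha i
    obtain ⟨θ, k1, k2, k3, k4⟩ := hb i
    refine ⟨η + θ, by rw [Pi.add_apply, ← h1, ← k1]; rfl, h2.add k2, ?_, ?_⟩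
    · filter_upwards [h3, k3, h2.eventually_analyticAt, k2.eventually_analyticAt] with z p q r s
      have e : fderiv ℂ (η + θ) z = fderiv ℂ η z + fderiv ℂ θ z :=
        fderiv_add r.differentiableAt s.differentiableAt
      refine ContinuousLinearMap.ext fun v => ContinuousLinearMap.ext fun w => ?_
      have p' : extD η z v w = 0 := by rw [p]; rfl
      have q' : extD θ z v w = 0 := by rw [q]; rfl
      change extD (η + θ) z v w = 0
      rw [extD_apply] at p' q' ⊢
      rw [e]
      simp only [add_apply]
      linear_combination p' + q'
    · filter_upwards [h4, k4] with z p q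
      refine ContinuousLinearMap.ext fun v => ContinuousLinearMap.ext fun w => ?_
      have p' : wedge (η z) ((W.fol i).form z) v w = 0 := by rw [p]; rfl
      have q' : wedge (θ z) ((W.fol i).form z) v w = 0 := by rw [q]; rfl
      change wedge ((η + θ) z) ((W.fol i).form z) v w = 0
      rw [wedge_apply] at p' q' ⊢
      simp only [Pi.add_apply, add_apply]
      linear_combination p' + q'
  smul_mem' := by
    rintro c a ⟨ha, ha'⟩
    refine ⟨fun i => ?_, by simp [← Finset.smul_sum, ha']⟩
    obtain ⟨η, h1, h2, h3, h4⟩ := ha i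
    refine ⟨c • η, by rw [Pi.smul_apply, ← h1]; rfl, analyticAt_const.smul h2, ?_, ?_⟩
    · filter_upwards [h3, h2.eventually_analyticAt] with z p r
      have e : fderiv ℂ (c • η) z = c • fderiv ℂ η z :=
        fderiv_const_smul r.differentiableAt c
      refine ContinuousLinearMap.ext fun v => ContinuousLinearMap.ext fun w => ?_
      have p' : extD η z v w = 0 := by rw [p]; rfl
      change extD (c • η) z v w = 0
      rw [extD_apply] at p' ⊢
      rw [e]
      simp only [smul_apply, smul_eq_mul]
      linear_combination c * p'
    · filter_upwards [h4] with z p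
      refine ContinuousLinearMap.ext fun v => ContinuousLinearMap.ext fun w => ?_
      have p' : wedge (η z) ((W.fol i).form z) v w = 0 := by rw [p]; rfl
      change wedge ((c • η) z) ((W.fol i).form z) v w = 0
      rw [wedge_apply] at p' ⊢
      simp only [Pi.smul_apply, smul_apply, smul_eq_mul]
      linear_combination c * p'

/-- The rank of a web: the dimension of its space of abelian relations. -/
def Web.rank {k : ℕ} (W : Web k) : ℕ := Module.finrank ℂ W.abelianRelations

/-- A `k`-web has maximal rank when its rank is `(k-1)(k-2)/2`. -/
def Web.HasMaximalRank {k : ℕ} (W : Web k) : Prop :=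
  (W.rank : ℚ) = ((k : ℚ) - 1) * ((k : ℚ) - 2) / 2

/-- A germ of holomorphic vector field on `(ℂ², 0)`. -/
structure VectorFieldGerm where
  /-- the vector field -/
  toFun : Plane → Plane
  analyticAt : AnalyticAt ℂ toFun 0

/-- The Lie derivative `L_X ω = i_X dω + d(i_X ω)` of a `1`-form. -/
def lieDerivative (X : VectorFieldGerm) (ω : OneForm) : OneForm := fun z =>
  extD ω z (X.toFun z) + fderiv ℂ (fun w => ω w (X.toFun w)) z

/-- `X` is an infinitesimal automorphism of the foliation induced by `ω`: the local flow of `X`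
preserves the foliation, that is, `L_X ω ∧ ω = 0` near the origin. -/
def VectorFieldGerm.IsInfinitesimalAutomorphismOf (X : VectorFieldGerm) (F : FoliationGerm) :
    Prop :=
  ∀ᶠ z in 𝓝 (0 : Plane), wedge (lieDerivative X F.form z) (F.form z) = 0

/-- `X` is an infinitesimal automorphism of all the foliations of `W`. -/
def VectorFieldGerm.IsInfinitesimalAutomorphism {k : ℕ} (X : VectorFieldGerm) (W : Web k) : Prop :=
  ∀ i, X.IsInfinitesimalAutomorphismOf (W.fol i)

/-- `X` is regular, and transverse to the foliations of `W`, at (equivalently, near) the origin. -/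
structure VectorFieldGerm.IsTransverse {k : ℕ} (X : VectorFieldGerm) (W : Web k) : Prop where
  regular : X.toFun 0 ≠ 0
  transverse : ∀ i, X.toFun 0 ∉ (W.fol i).tangentSpace 0

/-- The foliation `F_X` of a vector field `X` with `X(0) ≠ 0`, whose leaves are the trajectories
of `X`: for `X = a ∂/∂x + b ∂/∂y` it is induced by the `1`-form `a dy - b dx`. -/
def VectorFieldGerm.foliation (X : VectorFieldGerm) (h : X.toFun 0 ≠ 0) : FoliationGerm where
  form := fun z => (X.toFun z).1 • ContinuousLinearMap.snd ℂ ℂ ℂ -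
    (X.toFun z).2 • ContinuousLinearMap.fst ℂ ℂ ℂ
  analyticAt :=
    ((analyticAt_fst.comp X.analyticAt).smul analyticAt_const).sub
      ((analyticAt_snd.comp X.analyticAt).smul analyticAt_const)
  form_zero_ne := by
    intro e
    apply h
    have h1 := DFunLike.congr_fun e ((0 : ℂ), (1 : ℂ))
    have h2 := DFunLike.congr_fun e ((1 : ℂ), (0 : ℂ))
    simp at h1 h2
    exact Prod.ext h1 h2

theorem VectorFieldGerm.mem_tangentSpace_foliation (X : VectorFieldGerm) (h : X.toFun 0 ≠ 0)
    (z : Plane) : X.toFun z ∈ (X.foliation h).tangentSpace z := by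
  simp [FoliationGerm.tangentSpace, VectorFieldGerm.foliation]
  ring

/-- The web `W ⊠ F_X`, for a vector field `X` transverse to `W`. -/
def Web.superposeVectorField {k : ℕ} (W : Web k) (X : VectorFieldGerm) (h : X.IsTransverse W) :
    Web (k + 1) :=
  W.superpose (X.foliation h.regular) fun i e =>
    h.transverse i (e ▸ X.mem_tangentSpace_foliation h.regular 0)

end PlanarWeb

end

noncomputable section

namespace PlanarWeb

/-! ### The ring of germs of holomorphic functions -/

/-! Transversality makes `ω_i(X)` a unit, so each `ω_i` may be divided by it. After this the
automorphism condition says exactly that `ω_i` is closed (`IsInfinitesimalAutomorphismOf.closed`),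
and a first integral `f` of the `i`-th foliation satisfies `df = X(f) ω_i`.

Abelian relations of `W` become tuples of first integrals with `∑ f_i ω_i = 0`. A relation of `W ⊠
F_X` is `∑ f_i ω_i + η = 0` with `η(X) = 0`; contracting with `X` turns this into `∑ f_i = 0`, and
`η` is determined and automatically closed. Applying `X` to each entry maps the second space to the
first, since `∑ X(f_i) ω_i = d(∑ f_i)`. The map is onto by the Poincaré lemma
(`differentiate_surjective`), and its kernel is the space of constant tuples with sum zero, of
dimension `k - 1` (`kerEquiv`). Rank-nullity gives the formula.

Finite dimension comes from jets. Differentiating a relation `n` times bounds the `X^n(f_i)` by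
lower derivatives through a Vandermonde system (`sum_mem_jetIdeal`), so the derivatives of order
less than `k` at the origin determine all the others. A tuple for which they all vanish is zero by
Taylor expansion (`eq_zero_of_mem_stable`). -/

instance : Algebra ℂ (Germ (𝓝 (0 : Plane)) ℂ) :=
  Algebra.ofModule
    (by
      intro r x y
      induction x, y using Germ.inductionOn₂ with | _ f g
      exact congrArg _ (funext fun z => smul_mul_assoc r (f z) (g z)))
    (by
      intro r x y
      induction x, y using Germ.inductionOn₂ with | _ f g
      exact congrArg _ (funext fun z => mul_smul_comm r (f z) (g z)))

theorem germ_algebraMap (c : ℂ) :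
    algebraMap ℂ (Germ (𝓝 (0 : Plane)) ℂ) c = ((fun _ => c : Plane → ℂ) : Germ (𝓝 (0 : Plane)) ℂ) := by
  rw [Algebra.algebraMap_eq_smul_one]
  exact congrArg _ (funext fun z => mul_one c)

/-- The germs of holomorphic functions, as a subalgebra of the algebra of all germs. -/
def holGermSubalgebra : Subalgebra ℂ (Germ (𝓝 (0 : Plane)) ℂ) where
  carrier := {g | ∃ f : Plane → ℂ, AnalyticAt ℂ f 0 ∧ (f : Germ (𝓝 (0 : Plane)) ℂ) = g}
  mul_mem' := by
    rintro _ _ ⟨f, hf, rfl⟩ ⟨g, hg, rfl⟩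
    exact ⟨f * g, hf.mul hg, rfl⟩
  add_mem' := by
    rintro _ _ ⟨f, hf, rfl⟩ ⟨g, hg, rfl⟩
    exact ⟨f + g, hf.add hg, rfl⟩
  algebraMap_mem' c := ⟨fun _ => c, analyticAt_const, (germ_algebraMap c).symm⟩

/-- The ring of germs at the origin of holomorphic functions. -/
def HolGerm : Type := holGermSubalgebra

instance : CommRing HolGerm := inferInstanceAs (CommRing holGermSubalgebra)

instance : Algebra ℂ HolGerm := inferInstanceAs (Algebra ℂ holGermSubalgebra)

namespace HolGerm

/-- The germ of a function which is holomorphic at the origin. -/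
def mk (f : Plane → ℂ) (hf : AnalyticAt ℂ f 0) : HolGerm := ⟨f, f, hf, rfl⟩

theorem exists_mk (a : HolGerm) : ∃ f hf, mk f hf = a := by
  obtain ⟨_, f, hf, rfl⟩ := a
  exact ⟨f, hf, rfl⟩

theorem mk_eq_mk {f g : Plane → ℂ} {hf : AnalyticAt ℂ f 0} {hg : AnalyticAt ℂ g 0} :
    mk f hf = mk g hg ↔ f =ᶠ[𝓝 0] g :=
  Subtype.ext_iff.trans Germ.coe_eq

theorem mk_add {f g : Plane → ℂ} (hf : AnalyticAt ℂ f 0) (hg : AnalyticAt ℂ g 0) :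
    mk f hf + mk g hg = mk (fun z => f z + g z) (hf.add hg) := rfl

theorem mk_neg {f : Plane → ℂ} (hf : AnalyticAt ℂ f 0) :
    -mk f hf = mk (fun z => -f z) hf.neg := rfl

theorem mk_sub {f g : Plane → ℂ} (hf : AnalyticAt ℂ f 0) (hg : AnalyticAt ℂ g 0) :
    mk f hf - mk g hg = mk (fun z => f z - g z) (hf.sub hg) := rfl

theorem mk_mul {f g : Plane → ℂ} (hf : AnalyticAt ℂ f 0) (hg : AnalyticAt ℂ g 0) :
    mk f hf * mk g hg = mk (fun z => f z * g z) (hf.mul hg) := rfl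

theorem mk_smul (c : ℂ) {f : Plane → ℂ} (hf : AnalyticAt ℂ f 0) :
    c • mk f hf = mk (fun z => c * f z) (analyticAt_const.mul hf) := rfl

theorem algebraMap_eq (c : ℂ) : algebraMap ℂ HolGerm c = mk (fun _ => c) analyticAt_const :=
  Subtype.ext (germ_algebraMap c)

theorem mk_eq_zero {f : Plane → ℂ} {hf : AnalyticAt ℂ f 0} :
    mk f hf = 0 ↔ ∀ᶠ z in 𝓝 0, f z = 0 :=
  mk_eq_mk (hg := analyticAt_const (v := 0))

/-- The value at the origin. -/
def ev : HolGerm →ₐ[ℂ] ℂ where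
  toFun a := a.1.value
  map_one' := rfl
  map_zero' := rfl
  map_mul' a b := by
    obtain ⟨f, hf, rfl⟩ := exists_mk a
    obtain ⟨g, hg, rfl⟩ := exists_mk b
    rfl
  map_add' a b := by
    obtain ⟨f, hf, rfl⟩ := exists_mk a
    obtain ⟨g, hg, rfl⟩ := exists_mk b
    rfl
  commutes' c := by
    rw [algebraMap_eq]
    rfl

@[simp] theorem ev_mk {f : Plane → ℂ} (hf : AnalyticAt ℂ f 0) : ev (mk f hf) = f 0 := rfl

theorem analyticAt_fderiv_apply {f : Plane → ℂ} (hf : AnalyticAt ℂ f 0) (v : Plane) :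
    AnalyticAt ℂ (fun z => fderiv ℂ f z v) 0 :=
  ((ContinuousLinearMap.apply ℂ ℂ v :
    (Plane →L[ℂ] ℂ) →L[ℂ] ℂ).analyticAt (fderiv ℂ f 0)).comp (f := fderiv ℂ f) hf.fderiv

/-- The directional derivative of a germ of holomorphic function, as a germ. -/
def pdAux (v : Plane) (a : HolGerm) : HolGerm :=
  mk (fun z => fderiv ℂ (exists_mk a).choose z v)
    (analyticAt_fderiv_apply (exists_mk a).choose_spec.choose v)

theorem pdAux_mk (v : Plane) {f : Plane → ℂ} (hf : AnalyticAt ℂ f 0) :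
    pdAux v (mk f hf) = mk (fun z => fderiv ℂ f z v) (analyticAt_fderiv_apply hf v) := by
  have h := (exists_mk (mk f hf)).choose_spec.choose_spec
  rw [mk_eq_mk] at h
  unfold pdAux
  rw [mk_eq_mk]
  filter_upwards [h.fderiv (𝕜 := ℂ)] with z hz
  rw [hz]

/-- The directional derivative, as a derivation of the ring of germs of holomorphic functions. -/
def pd (v : Plane) : Derivation ℂ HolGerm HolGerm where
  toFun := pdAux v
  map_add' a b := by
    obtain ⟨f, hf, rfl⟩ := exists_mk a
    obtain ⟨g, hg, rfl⟩ := exists_mk b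
    rw [mk_add, pdAux_mk, pdAux_mk, pdAux_mk, mk_add, mk_eq_mk]
    filter_upwards [hf.eventually_analyticAt, hg.eventually_analyticAt] with z h1 h2
    rw [fderiv_fun_add h1.differentiableAt h2.differentiableAt]
    rfl
  map_smul' c a := by
    obtain ⟨f, hf, rfl⟩ := exists_mk a
    rw [mk_smul, pdAux_mk, pdAux_mk, RingHom.id_apply, mk_smul, mk_eq_mk]
    filter_upwards [hf.eventually_analyticAt] with z h1
    rw [fderiv_const_mul h1.differentiableAt]
    rfl
  map_one_eq_zero' := by
    change pdAux v (mk (fun _ => 1) analyticAt_const) = 0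
    rw [pdAux_mk, mk_eq_zero]
    exact .of_forall fun z => by simp
  leibniz' a b := by
    obtain ⟨f, hf, rfl⟩ := exists_mk a
    obtain ⟨g, hg, rfl⟩ := exists_mk b
    change pdAux v _ = _ * pdAux v _ + _ * pdAux v _
    rw [mk_mul, pdAux_mk, pdAux_mk, pdAux_mk, mk_mul, mk_mul, mk_add, mk_eq_mk]
    filter_upwards [hf.eventually_analyticAt, hg.eventually_analyticAt] with z h1 h2
    rw [fderiv_fun_mul h1.differentiableAt h2.differentiableAt]
    rfl

theorem pd_mk (v : Plane) {f : Plane → ℂ} (hf : AnalyticAt ℂ f 0) :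
    pd v (mk f hf) = mk (fun z => fderiv ℂ f z v) (analyticAt_fderiv_apply hf v) :=
  pdAux_mk v hf

/-- The partial derivative in the first variable. -/
abbrev dx : Derivation ℂ HolGerm HolGerm := pd (1, 0)

/-- The partial derivative in the second variable. -/
abbrev dy : Derivation ℂ HolGerm HolGerm := pd (0, 1)

theorem pd_eq (v : Plane) (a : HolGerm) : pd v a = v.1 • dx a + v.2 • dy a := by
  obtain ⟨f, hf, rfl⟩ := exists_mk a
  rw [pd_mk, pd_mk, pd_mk, mk_smul, mk_smul, mk_add, mk_eq_mk]
  refine .of_forall fun z => ?_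
  have : v = v.1 • ((1, 0) : Plane) + v.2 • ((0, 1) : Plane) := by ext <;> simp
  conv_lhs => rw [this]
  simp only [map_add, map_smul, smul_eq_mul]

theorem dx_dy_comm (a : HolGerm) : dx (dy a) = dy (dx a) := by
  obtain ⟨f, hf, rfl⟩ := exists_mk a
  simp only [pd_mk, mk_eq_mk]
  filter_upwards [hf.eventually_analyticAt] with z h
  have hd := h.fderiv.differentiableAt
  have hs : IsSymmSndFDerivAt ℂ f z :=
    h.contDiffAt.isSymmSndFDerivAt (n := ⊤) (by simp)
  simp [fderiv_clm_apply hd, hs.eq (1, 0) (0, 1)]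

theorem exists_mul_eq_one {h : HolGerm} (h0 : ev h ≠ 0) : ∃ u, h * u = 1 := by
  obtain ⟨f, hf, rfl⟩ := exists_mk h
  refine ⟨mk (fun z => (f z)⁻¹) (hf.inv h0), ?_⟩
  rw [mk_mul]
  refine mk_eq_mk (hg := analyticAt_const (v := 1)) |>.2 ?_
  filter_upwards [hf.continuousAt.eventually_ne h0] with z hz
  exact mul_inv_cancel₀ hz

/-- Algebraic access to the Taylor coefficients along `v`: it lets an argument about ideals stable
under derivations conclude that a power series vanishes. -/
theorem iteratedFDeriv_diag_mk (v : Plane) (n : ℕ) {f : Plane → ℂ} (hf : AnalyticAt ℂ f 0) :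
    ev ((pd v)^[n] (mk f hf)) = iteratedFDeriv ℂ n f 0 fun _ => v := by
  have key : ∀ n, ∃ hg : AnalyticAt ℂ (fun z => iteratedFDeriv ℂ n f z fun _ => v) 0,
      (pd v)^[n] (mk f hf) = mk _ hg := by
    intro n
    induction n with
    | zero =>
      refine ⟨by simpa using hf, ?_⟩
      simp
    | succ n ih =>
      obtain ⟨hg, e⟩ := ih
      have hev : (fun z => fderiv ℂ (fun z => iteratedFDeriv ℂ n f z fun _ => v) z v) =ᶠ[𝓝 0]
          fun z => iteratedFDeriv ℂ (n + 1) f z fun _ => v := by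
        filter_upwards [hf.eventually_analyticAt] with z h
        have hd : DifferentiableAt ℂ (iteratedFDeriv ℂ n f) z :=
          (h.contDiffAt (n := ⊤)).differentiableAt_iteratedFDeriv (m := n) (by simp)
        rw [iteratedFDeriv_succ_apply_left]
        have := hd.hasFDerivAt.continuousMultilinear_apply_const (fun _ => v)
        rw [this.fderiv]
        rfl
      refine ⟨(analyticAt_fderiv_apply hg v).congr hev, ?_⟩
      rw [Function.iterate_succ_apply', e, pd_mk, mk_eq_mk]
      exact hev
  obtain ⟨hg, e⟩ := key n
  rw [e]
  rfl

/-- An ideal stable under differentiation, all of whose elements vanish at the origin, is zero. -/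
theorem eq_zero_of_mem_stable {I : Ideal HolGerm} (hx : ∀ a ∈ I, dx a ∈ I)
    (hy : ∀ a ∈ I, dy a ∈ I) (h0 : ∀ a ∈ I, ev a = 0) {a : HolGerm} (ha : a ∈ I) : a = 0 := by
  obtain ⟨f, hf, rfl⟩ := exists_mk a
  have hst (v : Plane) (n : ℕ) : (pd v)^[n] (mk f hf) ∈ I := by
    induction n with
    | zero => exact ha
    | succ n ih =>
      rw [Function.iterate_succ_apply', pd_eq]
      exact I.add_mem (Submodule.smul_of_tower_mem _ _ (hx _ ih))
        (Submodule.smul_of_tower_mem _ _ (hy _ ih))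
  -- Every term of the Taylor series at `y` is the value at the origin of an iterated derivative
  -- along `y`, which lies in `I`.
  obtain ⟨p, r, hp⟩ := id hf
  rw [mk_eq_zero]
  filter_upwards [Metric.eball_mem_nhds (0 : Plane) hp.r_pos] with y hy
  have hs := hp.hasSum_iteratedFDeriv hy
  simp only [← iteratedFDeriv_diag_mk y _ hf, h0 _ (hst y _), smul_zero, zero_add] at hs
  exact hs.unique hasSum_zero

/-- The principal ideal generated by `a - a(0)` is stable, because its generator is killed by both
derivations, and it vanishes at the origin; hence it is zero. -/
theorem eq_algebraMap {a : HolGerm} (hx : dx a = 0) (hy : dy a = 0) :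
    a = algebraMap ℂ HolGerm (ev a) := by
  have key (D : Derivation ℂ HolGerm HolGerm) (hD : D a = 0) :
      ∀ b ∈ Ideal.span {a - algebraMap ℂ HolGerm (ev a)},
        D b ∈ Ideal.span {a - algebraMap ℂ HolGerm (ev a)} := by
    intro b hb
    obtain ⟨c, rfl⟩ := Ideal.mem_span_singleton'.1 hb
    rw [D.leibniz, map_sub, hD, D.map_algebraMap, sub_zero, smul_zero, zero_add, smul_eq_mul]
    exact Ideal.mem_span_singleton'.2 ⟨D c, mul_comm _ _⟩
  refine sub_eq_zero.1 (eq_zero_of_mem_stable (key dx hx) (key dy hy) ?_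
    (Ideal.mem_span_singleton_self _))
  intro b hb
  obtain ⟨c, rfl⟩ := Ideal.mem_span_singleton'.1 hb
  simp

end HolGerm

/-! ### The Poincaré lemma for germs of holomorphic forms -/

/-- A function with holomorphic derivative is analytic. -/
theorem analyticAt_of_hasFDerivAt {E F : Type*} [NormedAddCommGroup E] [NormedSpace ℂ E]
    [NormedAddCommGroup F] [NormedSpace ℂ F] [CompleteSpace F] {g : E → F} {η : E → E →L[ℂ] F}
    (hη : AnalyticAt ℂ η 0)
    (hg : ∀ᶠ z in 𝓝 0, HasFDerivAt g (η z) z) : AnalyticAt ℂ g 0 := by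
  obtain ⟨p, r₀, hp₀⟩ := hη
  obtain ⟨ε, hε, hg⟩ := EMetric.mem_nhds_iff.1 hg
  have hp := hp₀.mono (lt_min hp₀.r_pos hε) (min_le_left _ _)
  set r := min r₀ ε
  replace hg : ∀ z ∈ Metric.eball (0 : E) r, HasFDerivAt g (η z) z :=
    fun z hz => hg (Metric.eball_subset_eball (min_le_right _ _) hz)
  -- Integrating the degree `n` part of `η` along rays from the origin divides it by `n + 1`;
  -- `unshift` feeds the point to the remaining covector slot and adds the constant term.
  let q : FormalMultilinearSeries ℂ E (E →L[ℂ] F) := fun n => ((n : ℂ) + 1)⁻¹ • p n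
  refine ⟨q.unshift (g 0), r, ?_, hp.r_pos, fun {y} hy => ?_⟩
  · rw [FormalMultilinearSeries.radius_unshift]
    refine hp.r_le.trans (ENNReal.le_of_forall_nnreal_lt fun s hs => ?_)
    obtain ⟨C, -, hC⟩ := p.norm_mul_pow_le_of_lt_radius hs
    refine q.le_radius_of_bound C fun n => le_trans ?_ (hC n)
    gcongr
    have h1 : ‖((n : ℂ) + 1)⁻¹‖ ≤ 1 := by
      rw [norm_inv]
      refine inv_le_one_of_one_le₀ ?_
      rw [show ((n : ℂ) + 1) = ((n + 1 : ℕ) : ℂ) by push_cast; rfl, Complex.norm_natCast]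
      simp
    calc ‖((n : ℂ) + 1)⁻¹ • p n‖ = ‖((n : ℂ) + 1)⁻¹‖ * ‖p n‖ := norm_smul _ _
      _ ≤ ‖p n‖ := mul_le_of_le_one_left (norm_nonneg _) h1
  -- Reduction to one variable: the function `t ↦ g (t • y)` is complex differentiable on a disc
  -- containing `t = 1`, so its Taylor series converges there to `g y`.
  · have hmem : ∀ t ∈ Metric.eball (0 : ℂ) (r / ‖y‖ₑ), t • y ∈ Metric.eball (0 : E) r := by
      intro t ht
      rw [mem_eball_zero_iff] at ht ⊢
      rw [enorm_smul]
      exact ENNReal.mul_lt_of_lt_div ht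
    have h1 : (1 : ℂ) ∈ Metric.eball (0 : ℂ) (r / ‖y‖ₑ) := by
      rw [mem_eball_zero_iff] at hy ⊢
      rw [ENNReal.lt_div_iff_mul_lt (.inr (by simp)) (.inl enorm_ne_top)]
      simpa using hy
    have hφ : ∀ t ∈ Metric.eball (0 : ℂ) (r / ‖y‖ₑ),
        HasDerivAt (fun t : ℂ => g (t • y)) (η (t • y) y) t := by
      intro t ht
      have := (hg _ (hmem t ht)).comp_hasDerivAt t ((hasDerivAt_id t).smul_const y)
      simpa [Function.comp_def] using this
    have hpos : 0 < r / ‖y‖ₑ := lt_of_le_of_lt zero_le (mem_eball_zero_iff.1 h1)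
    have hψ : HasFPowerSeriesAt (fun t : ℂ => η (t • y) y)
        (fun n => ContinuousMultilinearMap.mkPiRing ℂ (Fin n) (p n (fun _ => y) y)) 0 := by
      refine hasFPowerSeriesAt_iff.2 ?_
      filter_upwards [Metric.eball_mem_nhds (0 : ℂ) hpos] with t ht
      have := (ContinuousLinearMap.apply ℂ F y).hasSum (hp.hasSum (hmem t ht))
      simp only [zero_add] at this ⊢
      convert this using 2 with n
      · have := (p n).map_smul_univ (fun _ => t) (fun _ => y)
        simp [this, FormalMultilinearSeries.coeff]
      · rfl
    have hcoef (n : ℕ) : iteratedDeriv (n + 1) (fun t : ℂ => g (t • y)) 0 =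
        (n.factorial : ℂ) • p n (fun _ => y) y := by
      have hev : deriv (fun t : ℂ => g (t • y)) =ᶠ[𝓝 0] fun t => η (t • y) y := by
        filter_upwards [Metric.eball_mem_nhds (0 : ℂ) hpos] with t ht using (hφ t ht).deriv
      obtain ⟨s, hs⟩ := hψ
      rw [iteratedDeriv_succ', hev.iteratedDeriv_eq, iteratedDeriv_eq_iteratedFDeriv,
        ← hs.factorial_smul]
      simp [Nat.cast_smul_eq_nsmul]
    have hsum := Complex.hasSum_taylorSeries_on_eball
      (fun t ht => (hφ t ht).differentiableAt.differentiableWithinAt) h1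
    simp only [one_smul, sub_zero, one_pow] at hsum
    rw [zero_add]
    convert hsum using 2 with n
    cases n with
    | zero => simp [FormalMultilinearSeries.unshift]
    | succ n =>
      rw [hcoef]
      have : (n.factorial : ℂ) ≠ 0 := Nat.cast_ne_zero.2 n.factorial_ne_zero
      rw [smul_smul, Nat.factorial_succ, Nat.cast_mul, mul_inv, mul_assoc, inv_mul_cancel₀ this,
        mul_one, Nat.cast_succ]
      rfl

namespace HolGerm

/-- Closed germs of holomorphic forms are exact. -/
theorem exists_primitive {a b : HolGerm} (h : dx b = dy a) : ∃ f, dx f = a ∧ dy f = b := by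
  obtain ⟨a, ha, rfl⟩ := exists_mk a
  obtain ⟨b, hb, rfl⟩ := exists_mk b
  rw [pd_mk, pd_mk, mk_eq_mk] at h
  set η : OneForm := fun z => a z • ContinuousLinearMap.fst ℂ ℂ ℂ +
    b z • ContinuousLinearMap.snd ℂ ℂ ℂ with hηdef
  have hη : AnalyticAt ℂ η 0 := (ha.smul analyticAt_const).add (hb.smul analyticAt_const)
  obtain ⟨ε, hε, hB⟩ := Metric.eventually_nhds_iff_ball.1
    (h.and (ha.eventually_analyticAt.and hb.eventually_analyticAt))
  have hd : ∀ z ∈ Metric.ball (0 : Plane) ε, HasFDerivAt η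
      ((fderiv ℂ a z).smulRight (ContinuousLinearMap.fst ℂ ℂ ℂ) +
        (fderiv ℂ b z).smulRight (ContinuousLinearMap.snd ℂ ℂ ℂ)) z := by
    intro z hz
    obtain ⟨-, h2, h3⟩ := hB z hz
    exact (h2.differentiableAt.hasFDerivAt.smul_const (ContinuousLinearMap.fst ℂ ℂ ℂ)).add
      (h3.differentiableAt.hasFDerivAt.smul_const (ContinuousLinearMap.snd ℂ ℂ ℂ))
  -- Closedness is symmetry of the derivative of `η`. By bilinearity it need only be known on the
  -- two basis vectors, where it is the equation `h`.
  obtain ⟨g, hg⟩ := (convex_ball (0 : Plane) ε).exists_forall_hasFDerivAt_of_fderiv_symmetric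
    (𝕜 := ℂ) Metric.isOpen_ball (ω := η)
    (fun z hz => ((hd z hz).restrictScalars ℝ).differentiableAt.differentiableWithinAt)
    (by
      intro z hz v w
      rw [((hd z hz).restrictScalars ℝ).fderiv]
      have e := (hB z hz).1
      have lin (c : Plane → ℂ) (u : Plane) :
          fderiv ℂ c z u = u.1 * fderiv ℂ c z (1, 0) + u.2 * fderiv ℂ c z (0, 1) := by
        have : u = u.1 • ((1, 0) : Plane) + u.2 • ((0, 1) : Plane) := by ext <;> simp
        conv_lhs => rw [this]
        simp only [map_add, map_smul, smul_eq_mul]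
      simp [lin a v, lin a w, lin b v, lin b w]
      linear_combination (v.1 * w.2 - w.1 * v.2) * e)
  have hg' : ∀ᶠ z in 𝓝 0, HasFDerivAt g (η z) z := by
    filter_upwards [Metric.ball_mem_nhds 0 hε] with z hz using hg z hz
  refine ⟨mk g (analyticAt_of_hasFDerivAt hη hg'), ?_, ?_⟩
  all_goals
    rw [pd_mk, mk_eq_mk]
    filter_upwards [hg'] with z hz
    rw [hz.fderiv]
    simp [hηdef]

end HolGerm

/-! ### Webs normalised by a transverse infinitesimal automorphism -/

/-- By the Leibniz rule, stability can be tested on generators. The target ideal may be larger than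
the span, as needed when differentiation raises the order of a jet. -/
theorem derivation_mem_of_mem_span {R A : Type*} [CommRing R] [CommRing A] [Algebra R A]
    (D : Derivation R A A) {S : Set A} {I : Ideal A} (h : ∀ a ∈ S, a ∈ I) (hD : ∀ a ∈ S, D a ∈ I)
    {a : A} (ha : a ∈ Ideal.span S) : D a ∈ I := by
  have hle : Ideal.span S ≤ I := Ideal.span_le.2 h
  induction ha using Submodule.span_induction with
  | mem x hx => exact hD x hx
  | zero => simp
  | add x y hx hy h1 h2 => rw [map_add]; exact I.add_mem h1 h2
  | smul c x hx h1 =>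
    rw [smul_eq_mul, D.leibniz]
    exact I.add_mem (I.smul_mem _ h1) (I.mul_mem_right _ (hle hx))

open HolGerm

/-- A vector field `X = s ∂/∂x + t ∂/∂y` and closed forms `ω_i = α_i dx + β_i dy` such that
`ω_i(X) = 1`. -/
structure NormalizedWeb (k : ℕ) where
  /-- first component of the vector field -/
  s : HolGerm
  /-- second component of the vector field -/
  t : HolGerm
  /-- first components of the forms -/
  α : Fin k → HolGerm
  /-- second components of the forms -/
  β : Fin k → HolGerm
  contract : ∀ i, s * α i + t * β i = 1
  closed : ∀ i, dx (β i) = dy (α i)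

namespace NormalizedWeb

variable {k : ℕ} (N : NormalizedWeb k)

/-- The derivation along the vector field. -/
def X : Derivation ℂ HolGerm HolGerm := N.s • dx + N.t • dy

theorem X_apply (f : HolGerm) : N.X f = N.s * dx f + N.t * dy f := rfl

/-- `df ∧ ω_i = 0`: the germ `f` is a first integral of the `i`-th foliation. -/
def IsFirstIntegral (i : Fin k) (f : HolGerm) : Prop := N.β i * dx f = N.α i * dy f

variable {N} {i : Fin k} {f : HolGerm}

/-- Since `ω_i` is closed, `d(f ω_i) = df ∧ ω_i`. -/
theorem isFirstIntegral_iff_closed :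
    N.IsFirstIntegral i f ↔ dx (f * N.β i) = dy (f * N.α i) := by
  rw [IsFirstIntegral, dx.leibniz, dy.leibniz, N.closed i]
  simp only [smul_eq_mul]
  exact (add_right_inj _).symm

/-- `df` is a multiple of `ω_i`, and contraction with the vector field identifies the factor as
`X(f)`, because `ω_i(X) = 1`. -/
theorem IsFirstIntegral.dx_eq (h : N.IsFirstIntegral i f) : dx f = N.X f * N.α i := by
  unfold IsFirstIntegral at h
  rw [X_apply]
  linear_combination (-dx f) * N.contract i + N.t * h

theorem IsFirstIntegral.dy_eq (h : N.IsFirstIntegral i f) : dy f = N.X f * N.β i := by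
  unfold IsFirstIntegral at h
  rw [X_apply]
  linear_combination (-dy f) * N.contract i - N.s * h

/-- The form `X(f) ω_i = df` is exact, hence closed. -/
theorem IsFirstIntegral.X (h : N.IsFirstIntegral i f) : N.IsFirstIntegral i (N.X f) := by
  rw [isFirstIntegral_iff_closed, ← h.dx_eq, ← h.dy_eq, dx_dy_comm]

theorem IsFirstIntegral.add {g : HolGerm} (hf : N.IsFirstIntegral i f)
    (hg : N.IsFirstIntegral i g) : N.IsFirstIntegral i (f + g) := by
  unfold IsFirstIntegral at *
  rw [map_add, map_add]
  linear_combination hf + hg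

theorem IsFirstIntegral.smul (c : ℂ) (hf : N.IsFirstIntegral i f) :
    N.IsFirstIntegral i (c • f) := by
  unfold IsFirstIntegral at *
  rw [Derivation.map_smul, Derivation.map_smul, mul_smul_comm, mul_smul_comm, hf]

theorem isFirstIntegral_algebraMap (c : ℂ) : N.IsFirstIntegral i (algebraMap ℂ HolGerm c) := by
  simp [IsFirstIntegral]

theorem IsFirstIntegral.eq_algebraMap (h : N.IsFirstIntegral i f) (h0 : N.X f = 0) :
    f = algebraMap ℂ HolGerm (ev f) :=
  HolGerm.eq_algebraMap (by rw [h.dx_eq, h0, zero_mul]) (by rw [h.dy_eq, h0, zero_mul])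

/-- Take for `F` a primitive of the closed form `f ω_i`. -/
theorem IsFirstIntegral.exists_X_eq (h : N.IsFirstIntegral i f) :
    ∃ F, N.IsFirstIntegral i F ∧ N.X F = f := by
  obtain ⟨F, h1, h2⟩ := exists_primitive (isFirstIntegral_iff_closed.1 h)
  refine ⟨F, ?_, ?_⟩
  · rw [IsFirstIntegral, h1, h2]
    ring
  · rw [X_apply, h1, h2]
    linear_combination f * N.contract i

/-! ### Comparison of the two spaces of relations -/

variable (N)

/-- The abelian relations `∑ f_i ω_i = 0`, given by their coefficients `f_i`. -/
def coeffRelations : Submodule ℂ (Fin k → HolGerm) where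
  carrier := {f | (∀ i, N.IsFirstIntegral i (f i)) ∧
    ∑ i, f i * N.α i = 0 ∧ ∑ i, f i * N.β i = 0}
  zero_mem' := ⟨fun i => by simp [IsFirstIntegral], by simp, by simp⟩
  add_mem' := fun {f g} hf hg => ⟨fun i => (hf.1 i).add (hg.1 i),
    by simp [add_mul, Finset.sum_add_distrib, hf.2.1, hg.2.1],
    by simp [add_mul, Finset.sum_add_distrib, hf.2.2, hg.2.2]⟩
  smul_mem' := fun c f hf => ⟨fun i => (hf.1 i).smul c,
    by simp [← Finset.smul_sum, hf.2.1], by simp [← Finset.smul_sum, hf.2.2]⟩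

/-- The tuples of first integrals with `∑ f_i = 0`; these are the coefficients of the abelian
relations `∑ f_i ω_i + η = 0`, where the form `η` is killed by the vector field. -/
def sumZeroIntegrals : Submodule ℂ (Fin k → HolGerm) where
  carrier := {f | (∀ i, N.IsFirstIntegral i (f i)) ∧ ∑ i, f i = 0}
  zero_mem' := ⟨fun i => by simp [IsFirstIntegral], by simp⟩
  add_mem' := fun {f g} hf hg => ⟨fun i => (hf.1 i).add (hg.1 i),
    by simp [Finset.sum_add_distrib, hf.2, hg.2]⟩
  smul_mem' := fun c f hf => ⟨fun i => (hf.1 i).smul c, by simp [← Finset.smul_sum, hf.2]⟩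

/-- Differentiation along the vector field. -/
def differentiate : N.sumZeroIntegrals →ₗ[ℂ] N.coeffRelations :=
  (N.X.toLinearMap.compLeft (Fin k)).restrict fun f hf => by
    refine ⟨fun i => (hf.1 i).X, ?_, ?_⟩
    · have h : ∀ i, N.X (f i) * N.α i = dx (f i) := fun i => (hf.1 i).dx_eq.symm
      change ∑ i, N.X (f i) * N.α i = 0
      simp only [h, ← map_sum, hf.2, map_zero]
    · have h : ∀ i, N.X (f i) * N.β i = dy (f i) := fun i => (hf.1 i).dy_eq.symm
      change ∑ i, N.X (f i) * N.β i = 0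
      simp only [h, ← map_sum, hf.2, map_zero]

theorem differentiate_apply (f : N.sumZeroIntegrals) (i : Fin k) :
    (N.differentiate f : Fin k → HolGerm) i = N.X ((f : Fin k → HolGerm) i) := rfl

theorem differentiate_surjective (hk : 1 ≤ k) : Function.Surjective N.differentiate := by
  rintro ⟨f, hf, hα, hβ⟩
  choose F hF hFf using fun i => (hf i).exists_X_eq
  have hx : dx (∑ i, F i) = 0 := by
    rw [map_sum, ← hα]
    exact Finset.sum_congr rfl fun i _ => by rw [(hF i).dx_eq, hFf]
  have hy : dy (∑ i, F i) = 0 := by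
    rw [map_sum, ← hβ]
    exact Finset.sum_congr rfl fun i _ => by rw [(hF i).dy_eq, hFf]
  have hc := HolGerm.eq_algebraMap hx hy
  set c := ev (∑ i, F i)
  -- The primitives sum to a constant `c`; subtracting it from a single entry corrects the sum
  -- without changing the derivatives.
  let j : Fin k := ⟨0, hk⟩
  refine ⟨⟨fun i => F i + algebraMap ℂ HolGerm (if i = j then -c else 0),
    fun i => (hF i).add (isFirstIntegral_algebraMap _), ?_⟩, ?_⟩
  · rw [Finset.sum_add_distrib, ← map_sum, Finset.sum_ite_eq' Finset.univ j, hc, ← map_add]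
    simp
  · refine Subtype.ext (funext fun i => ?_)
    rw [differentiate_apply]
    simp [hFf]

/-- The tuples of complex numbers with sum zero. -/
def sumZero (k : ℕ) : Submodule ℂ (Fin k → ℂ) :=
  LinearMap.ker (∑ i, LinearMap.proj i : (Fin k → ℂ) →ₗ[ℂ] ℂ)

theorem mem_sumZero {c : Fin k → ℂ} : c ∈ sumZero k ↔ ∑ i, c i = 0 := by
  simp [sumZero]

theorem finrank_sumZero (hk : 1 ≤ k) : Module.finrank ℂ (sumZero k) = k - 1 := by
  have h := (∑ i, LinearMap.proj i : (Fin k → ℂ) →ₗ[ℂ] ℂ).finrank_range_add_finrank_ker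
  rw [LinearMap.range_eq_top.2, finrank_top, Module.finrank_self, Module.finrank_fin_fun] at h
  · unfold sumZero
    omega
  · intro c
    refine ⟨Pi.single ⟨0, hk⟩ c, ?_⟩
    simp

/-- The kernel of the differentiation consists of constants with sum zero. -/
def kerEquiv : LinearMap.ker N.differentiate ≃ₗ[ℂ] sumZero k := by
  have hker (f : LinearMap.ker N.differentiate) (i : Fin k) :
      (f.1 : Fin k → HolGerm) i = algebraMap ℂ HolGerm (ev ((f.1 : Fin k → HolGerm) i)) := by
    refine (f.1.2.1 i).eq_algebraMap ?_
    rw [← differentiate_apply, LinearMap.mem_ker.1 f.2]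
    rfl
  let φ : LinearMap.ker N.differentiate →ₗ[ℂ] sumZero k :=
    (((ev.toLinearMap.compLeft (Fin k)).comp N.sumZeroIntegrals.subtype).comp
      (LinearMap.ker N.differentiate).subtype).codRestrict _ fun f => by
        rw [mem_sumZero]
        change ∑ i, ev ((f.1 : Fin k → HolGerm) i) = 0
        rw [← map_sum, f.1.2.2, map_zero]
  have hφ (f : LinearMap.ker N.differentiate) (i : Fin k) :
      (φ f : Fin k → ℂ) i = ev ((f.1 : Fin k → HolGerm) i) := rfl
  refine LinearEquiv.ofBijective φ ⟨?_, ?_⟩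
  · intro f g h
    refine Subtype.ext (Subtype.ext (funext fun i => ?_))
    rw [hker f, hker g, ← hφ, ← hφ, h]
  · rintro ⟨c, hc⟩
    rw [mem_sumZero] at hc
    refine ⟨⟨⟨fun i => algebraMap ℂ HolGerm (c i), fun i => isFirstIntegral_algebraMap _,
      by rw [← map_sum, hc, map_zero]⟩, ?_⟩, ?_⟩
    · rw [LinearMap.mem_ker]
      refine Subtype.ext (funext fun i => ?_)
      rw [differentiate_apply]
      simp
    · refine Subtype.ext (funext fun i => ?_)
      rw [hφ]
      simp

/-- An extension of finite-dimensional spaces: the kernel consists of constants, and the quotient by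
it embeds in the relations. -/
theorem finite_sumZeroIntegrals [Module.Finite ℂ N.coeffRelations] :
    Module.Finite ℂ N.sumZeroIntegrals := by
  have : Module.Finite ℂ (LinearMap.ker N.differentiate) := .equiv N.kerEquiv.symm
  have : Module.Finite ℂ (N.sumZeroIntegrals ⧸ LinearMap.ker N.differentiate) :=
    .of_injective ((LinearMap.ker N.differentiate).liftQ N.differentiate le_rfl)
      (LinearMap.ker_eq_bot.1 (Submodule.ker_liftQ_eq_bot' _ _ rfl))
  exact .of_submodule_quotient (LinearMap.ker N.differentiate)

theorem finrank_sumZeroIntegrals (hk : 1 ≤ k) [Module.Finite ℂ N.coeffRelations] :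
    Module.finrank ℂ N.sumZeroIntegrals = Module.finrank ℂ N.coeffRelations + (k - 1) := by
  have := N.finite_sumZeroIntegrals
  rw [← N.differentiate.finrank_range_add_finrank_ker,
    LinearMap.range_eq_top.2 (N.differentiate_surjective hk), finrank_top,
    N.kerEquiv.finrank_eq, finrank_sumZero hk]

/-! ### Finiteness of the rank -/

variable {N}

theorem IsFirstIntegral.iterate_X (h : N.IsFirstIntegral i f) (m : ℕ) :
    N.IsFirstIntegral i (N.X^[m] f) := by
  induction m with
  | zero => exact h
  | succ m ih => rw [Function.iterate_succ_apply']; exact ih.X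

variable (N)

/-- The ideal generated by the derivatives of order less than `n` of the germs `f_i`. -/
def jetIdeal (f : Fin k → HolGerm) (n : ℕ) : Ideal HolGerm :=
  Ideal.span {g | ∃ i, ∃ m < n, N.X^[m] (f i) = g}

variable {N} {f : Fin k → HolGerm}

theorem iterate_mem_jetIdeal (i : Fin k) {m n : ℕ} (h : m < n) :
    N.X^[m] (f i) ∈ N.jetIdeal f n :=
  Ideal.subset_span ⟨i, m, h, rfl⟩

theorem dx_mem_jetIdeal (hf : ∀ i, N.IsFirstIntegral i (f i)) {n : ℕ} {g : HolGerm}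
    (hg : g ∈ N.jetIdeal f n) : dx g ∈ N.jetIdeal f (n + 1) := by
  refine derivation_mem_of_mem_span dx ?_ ?_ hg
  · rintro _ ⟨i, m, hm, rfl⟩
    exact iterate_mem_jetIdeal i (by omega)
  · rintro _ ⟨i, m, hm, rfl⟩
    rw [((hf i).iterate_X m).dx_eq, ← Function.iterate_succ_apply' N.X]
    exact Ideal.mul_mem_right _ _ (iterate_mem_jetIdeal i (by omega))

theorem dy_mem_jetIdeal (hf : ∀ i, N.IsFirstIntegral i (f i)) {n : ℕ} {g : HolGerm}
    (hg : g ∈ N.jetIdeal f n) : dy g ∈ N.jetIdeal f (n + 1) := by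
  refine derivation_mem_of_mem_span dy ?_ ?_ hg
  · rintro _ ⟨i, m, hm, rfl⟩
    exact iterate_mem_jetIdeal i (by omega)
  · rintro _ ⟨i, m, hm, rfl⟩
    rw [((hf i).iterate_X m).dy_eq, ← Function.iterate_succ_apply' N.X]
    exact Ideal.mul_mem_right _ _ (iterate_mem_jetIdeal i (by omega))

/-- The `n`-th derivatives satisfy `n + 2` independent-looking linear equations in each top degree,
modulo lower order. Since `d(X^n f_i) = X^(n+1)(f_i) ω_i`, applying `dx` or `dy` raises `n` and one
exponent together, and the Leibniz remainder has lower order. The case `n = 0` is the relation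
itself and its contraction with the vector field. -/
theorem sum_mem_jetIdeal (hf : f ∈ N.coeffRelations) (n : ℕ) :
    ∀ a b : ℕ, a + b ≤ n + 1 →
      ∑ i, N.X^[n] (f i) * (N.α i ^ a * N.β i ^ b) ∈ N.jetIdeal f n := by
  induction n with
  | zero =>
    intro a b hab
    have h0 : ∑ i, f i = 0 := by
      have : ∀ i, f i = N.s * (f i * N.α i) + N.t * (f i * N.β i) := fun i => by
        linear_combination (-f i) * N.contract i
      rw [Finset.sum_congr rfl fun i _ => this i, Finset.sum_add_distrib, ← Finset.mul_sum,
        ← Finset.mul_sum, hf.2.1, hf.2.2]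
      simp
    have : (a = 0 ∧ b = 0) ∨ (a = 1 ∧ b = 0) ∨ (a = 0 ∧ b = 1) := by omega
    rcases this with ⟨rfl, rfl⟩ | ⟨rfl, rfl⟩ | ⟨rfl, rfl⟩
    · simp [h0]
    · simp [hf.2.1]
    · simp [hf.2.2]
  | succ n ih =>
    intro a b hab
    have hl (i : Fin k) (c : HolGerm) : N.X^[n] (f i) * c ∈ N.jetIdeal f (n + 1) :=
      Ideal.mul_mem_right _ _ (iterate_mem_jetIdeal i (by omega))
    have hX (i : Fin k) : N.X^[n + 1] (f i) = N.X (N.X^[n] (f i)) :=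
      Function.iterate_succ_apply' _ _ _
    rcases Nat.eq_zero_or_pos a with rfl | ha
    · rcases Nat.eq_zero_or_pos b with rfl | hb
      · have h := ih 0 0 (by omega)
        simp only [pow_zero, mul_one, hX] at h ⊢
        rw [← map_sum, X_apply]
        exact Ideal.add_mem _ (Ideal.mul_mem_left _ _ (dx_mem_jetIdeal hf.1 h))
          (Ideal.mul_mem_left _ _ (dy_mem_jetIdeal hf.1 h))
      · obtain ⟨b, rfl⟩ : ∃ c, b = c + 1 := ⟨b - 1, by omega⟩
        have h := dy_mem_jetIdeal hf.1 (ih 0 b (by omega))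
        rw [map_sum] at h
        have e (i : Fin k) : N.X^[n + 1] (f i) * (N.α i ^ 0 * N.β i ^ (b + 1)) =
            dy (N.X^[n] (f i) * (N.α i ^ 0 * N.β i ^ b)) -
              N.X^[n] (f i) * dy (N.α i ^ 0 * N.β i ^ b) := by
          rw [dy.leibniz, (((hf.1 i).iterate_X n)).dy_eq, hX]
          simp only [smul_eq_mul]
          ring
        rw [Finset.sum_congr rfl fun i _ => e i, Finset.sum_sub_distrib]
        exact Ideal.sub_mem _ h (Ideal.sum_mem _ fun i _ => hl i _)
    · obtain ⟨a, rfl⟩ : ∃ c, a = c + 1 := ⟨a - 1, by omega⟩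
      have h := dx_mem_jetIdeal hf.1 (ih a b (by omega))
      rw [map_sum] at h
      have e (i : Fin k) : N.X^[n + 1] (f i) * (N.α i ^ (a + 1) * N.β i ^ b) =
          dx (N.X^[n] (f i) * (N.α i ^ a * N.β i ^ b)) -
            N.X^[n] (f i) * dx (N.α i ^ a * N.β i ^ b) := by
        rw [dx.leibniz, (((hf.1 i).iterate_X n)).dx_eq, hX]
        simp only [smul_eq_mul]
        ring
      rw [Finset.sum_congr rfl fun i _ => e i, Finset.sum_sub_distrib]
      exact Ideal.sub_mem _ h (Ideal.sum_mem _ fun i _ => hl i _)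

theorem ev_eq_zero_of_mem_jetIdeal {n : ℕ} (h : ∀ i, ∀ m < n, ev (N.X^[m] (f i)) = 0)
    {g : HolGerm} (hg : g ∈ N.jetIdeal f n) : ev g = 0 := by
  have : N.jetIdeal f n ≤ RingHom.ker (ev : HolGerm →ₐ[ℂ] ℂ) := by
    refine Ideal.span_le.2 ?_
    rintro _ ⟨i, m, hm, rfl⟩
    exact h i m hm
  exact this hg

/-- An abelian relation is determined by its jet of order `k - 1`. -/
theorem eq_zero_of_jet_eq_zero
    (hd : ∀ i j, i ≠ j → ev (N.α i) * ev (N.β j) ≠ ev (N.α j) * ev (N.β i))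
    (hf : f ∈ N.coeffRelations) (h : ∀ i, ∀ m < k, ev (N.X^[m] (f i)) = 0) : f = 0 := by
  have hall (n : ℕ) : ∀ i, ev (N.X^[n] (f i)) = 0 := by
    induction n using Nat.strong_induction_on with
    | _ n ih =>
    rcases lt_or_ge n k with hn | hn
    · exact fun i => h i n hn
    -- At the origin the lower derivatives vanish by induction, so the values of the `n`-th ones
    -- solve a homogeneous system in the monomials of degree `k - 1`, allowed because `k - 1 ≤ n +
    -- 1`. Its determinant is nonzero because the directions are pairwise distinct.
    · let M := Matrix.projVandermonde (fun i => ev (N.α i)) (fun i => ev (N.β i))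
      have hM : M.det ≠ 0 := by
        rw [Matrix.det_projVandermonde]
        refine Finset.prod_ne_zero_iff.2 fun i _ => Finset.prod_ne_zero_iff.2 fun j hj => ?_
        exact sub_ne_zero.2 (hd j i (Finset.mem_Ioi.1 hj).ne')
      have hv : Matrix.vecMul (fun i => ev (N.X^[n] (f i))) M = 0 := by
        funext j
        have := ev_eq_zero_of_mem_jetIdeal (fun i m hm => ih m hm i)
          (sum_mem_jetIdeal hf n j (j.rev : ℕ) (by rw [Fin.val_rev]; omega))
        simpa [Matrix.vecMul, dotProduct, M, Matrix.projVandermonde_apply] using this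
      exact fun i => congrFun (Matrix.eq_zero_of_vecMul_eq_zero hM hv) i
  -- The ideal of all derivatives is stable under `dx` and `dy` and vanishes at the origin.
  let I : Ideal HolGerm := Ideal.span {g | ∃ i m, N.X^[m] (f i) = g}
  have hI (i : Fin k) (m : ℕ) : N.X^[m] (f i) ∈ I := Ideal.subset_span ⟨i, m, rfl⟩
  funext i
  refine eq_zero_of_mem_stable (I := I) ?_ ?_ ?_ (hI i 0)
  · intro a ha
    refine derivation_mem_of_mem_span dx (fun _ h => Ideal.subset_span h) ?_ ha
    rintro _ ⟨i, m, rfl⟩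
    rw [((hf.1 i).iterate_X m).dx_eq, ← Function.iterate_succ_apply' N.X]
    exact I.mul_mem_right _ (hI i _)
  · intro a ha
    refine derivation_mem_of_mem_span dy (fun _ h => Ideal.subset_span h) ?_ ha
    rintro _ ⟨i, m, rfl⟩
    rw [((hf.1 i).iterate_X m).dy_eq, ← Function.iterate_succ_apply' N.X]
    exact I.mul_mem_right _ (hI i _)
  · have : I ≤ RingHom.ker (ev : HolGerm →ₐ[ℂ] ℂ) := by
      refine Ideal.span_le.2 ?_
      rintro _ ⟨i, m, rfl⟩
      exact hall m i
    exact fun a ha => this ha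

theorem finite_coeffRelations
    (hd : ∀ i j, i ≠ j → ev (N.α i) * ev (N.β j) ≠ ev (N.α j) * ev (N.β i)) :
    Module.Finite ℂ N.coeffRelations := by
  let φ : N.coeffRelations →ₗ[ℂ] (Fin k → Fin k → ℂ) :=
    LinearMap.pi fun i => LinearMap.pi fun m =>
      (ev.toLinearMap.comp (N.X.toLinearMap ^ (m : ℕ))).comp
        ((LinearMap.proj i).comp N.coeffRelations.subtype)
  refine .of_injective φ ?_
  rw [← LinearMap.ker_eq_bot, LinearMap.ker_eq_bot']
  intro f hf
  refine Subtype.ext (eq_zero_of_jet_eq_zero hd f.2 fun i m hm => ?_)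
  have := congrFun (congrFun hf i) ⟨m, hm⟩
  simpa [φ, Module.End.pow_apply] using this

end NormalizedWeb

/-! ### Germs of holomorphic forms -/

/-- The germ of form `a dx + b dy`. -/
def formGerm : HolGerm × HolGerm →ₗ[ℂ] Germ (𝓝 (0 : Plane)) (Plane →L[ℂ] ℂ) where
  toFun c := Germ.map₂ (fun a b => a • ContinuousLinearMap.fst ℂ ℂ ℂ +
    b • ContinuousLinearMap.snd ℂ ℂ ℂ) c.1.1 c.2.1
  map_add' := by
    rintro ⟨a, b⟩ ⟨c, d⟩
    obtain ⟨a, ha, rfl⟩ := exists_mk a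
    obtain ⟨b, hb, rfl⟩ := exists_mk b
    obtain ⟨c, hc, rfl⟩ := exists_mk c
    obtain ⟨d, hd, rfl⟩ := exists_mk d
    refine Germ.coe_eq.2 (.of_forall fun z => ?_)
    ext <;> simp
  map_smul' := by
    rintro c ⟨a, b⟩
    obtain ⟨a, ha, rfl⟩ := exists_mk a
    obtain ⟨b, hb, rfl⟩ := exists_mk b
    refine Germ.coe_eq.2 (.of_forall fun z => ?_)
    ext <;> simp

theorem formGerm_mk {a b : Plane → ℂ} (ha : AnalyticAt ℂ a 0) (hb : AnalyticAt ℂ b 0) :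
    formGerm (mk a ha, mk b hb) = ((fun z => a z • ContinuousLinearMap.fst ℂ ℂ ℂ +
      b z • ContinuousLinearMap.snd ℂ ℂ ℂ : OneForm) : Germ (𝓝 (0 : Plane)) (Plane →L[ℂ] ℂ)) :=
  rfl

theorem formGerm_injective : Function.Injective formGerm := by
  refine (injective_iff_map_eq_zero formGerm).2 ?_
  rintro ⟨a, b⟩ h
  obtain ⟨a, ha, rfl⟩ := exists_mk a
  obtain ⟨b, hb, rfl⟩ := exists_mk b
  rw [formGerm_mk] at h
  have h' := Germ.coe_eq.1 (h.trans Germ.coe_zero.symm)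
  refine Prod.ext ((mk_eq_zero (hf := ha)).2 ?_) ((mk_eq_zero (hf := hb)).2 ?_)
  · filter_upwards [h'] with z hz
    simpa using DFunLike.congr_fun hz (1, 0)
  · filter_upwards [h'] with z hz
    simpa using DFunLike.congr_fun hz (0, 1)

theorem analyticAt_form_apply {η : OneForm} (hη : AnalyticAt ℂ η 0) (v : Plane) :
    AnalyticAt ℂ (fun z => η z v) 0 :=
  ((ContinuousLinearMap.apply ℂ ℂ v :
    (Plane →L[ℂ] ℂ) →L[ℂ] ℂ).analyticAt (η 0)).comp (f := η) hη

/-- The coefficients of a germ of holomorphic form. -/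
def coeffs {η : OneForm} (hη : AnalyticAt ℂ η 0) : HolGerm × HolGerm :=
  (mk _ (analyticAt_form_apply hη (1, 0)), mk _ (analyticAt_form_apply hη (0, 1)))

theorem clm_apply (φ : Plane →L[ℂ] ℂ) (v : Plane) : φ v = v.1 * φ (1, 0) + v.2 * φ (0, 1) := by
  have : v = v.1 • ((1, 0) : Plane) + v.2 • ((0, 1) : Plane) := by ext <;> simp
  conv_lhs => rw [this]
  simp only [map_add, map_smul, smul_eq_mul]

theorem formGerm_coeffs {η : OneForm} (hη : AnalyticAt ℂ η 0) :
    formGerm (coeffs hη) = (η : Germ (𝓝 (0 : Plane)) (Plane →L[ℂ] ℂ)) := by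
  unfold coeffs
  rw [formGerm_mk]
  refine Germ.coe_eq.2 (.of_forall fun z => ?_)
  ext <;> simp

theorem fderiv_form_apply {η : OneForm} {z : Plane} (hη : AnalyticAt ℂ η z) (v w : Plane) :
    fderiv ℂ (fun z => η z w) z v = fderiv ℂ η z v w := by
  simp [fderiv_clm_apply hη.differentiableAt (differentiableAt_const w)]

theorem extD_eq_zero_iff (η : OneForm) (z : Plane) :
    extD η z = 0 ↔ fderiv ℂ η z (1, 0) (0, 1) = fderiv ℂ η z (0, 1) (1, 0) := by
  constructor
  · intro h
    have := DFunLike.congr_fun (DFunLike.congr_fun h (1, 0)) (0, 1)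
    rw [extD_apply] at this
    exact sub_eq_zero.1 this
  · intro h
    ext <;> simp [extD_apply, h]

theorem wedge_eq_zero_iff (φ ψ : Plane →L[ℂ] ℂ) :
    wedge φ ψ = 0 ↔ φ (1, 0) * ψ (0, 1) = φ (0, 1) * ψ (1, 0) := by
  constructor
  · intro h
    have := DFunLike.congr_fun (DFunLike.congr_fun h (1, 0)) (0, 1)
    rw [wedge_apply, mul_comm (ψ (1, 0))] at this
    exact sub_eq_zero.1 this
  · intro h
    refine ContinuousLinearMap.ext fun v => ContinuousLinearMap.ext fun w => ?_
    rw [wedge_apply, clm_apply φ v, clm_apply φ w, clm_apply ψ v, clm_apply ψ w]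
    simp
    linear_combination (v.1 * w.2 - v.2 * w.1) * h

theorem closed_iff_coeffs {η : OneForm} (hη : AnalyticAt ℂ η 0) :
    (∀ᶠ z in 𝓝 0, extD η z = 0) ↔ dx (coeffs hη).2 = dy (coeffs hη).1 := by
  unfold coeffs
  rw [pd_mk, pd_mk, mk_eq_mk]
  refine eventually_congr ?_
  filter_upwards [hη.eventually_analyticAt] with z hz
  rw [extD_eq_zero_iff, fderiv_form_apply hz, fderiv_form_apply hz]

theorem wedge_iff_coeffs {η ω : OneForm} (hη : AnalyticAt ℂ η 0) (hω : AnalyticAt ℂ ω 0) :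
    (∀ᶠ z in 𝓝 0, wedge (η z) (ω z) = 0) ↔
      (coeffs hη).1 * (coeffs hω).2 = (coeffs hη).2 * (coeffs hω).1 := by
  unfold coeffs
  rw [mk_mul, mk_mul, mk_eq_mk]
  exact eventually_congr (.of_forall fun z => wedge_eq_zero_iff _ _)

/-- The coefficients of the form inducing a foliation. -/
def FoliationGerm.coeffs (F : FoliationGerm) : HolGerm × HolGerm :=
  PlanarWeb.coeffs F.analyticAt

/-- The coefficients of the abelian relations of a web. -/
def Web.relationCoeffs {k : ℕ} (W : Web k) : Submodule ℂ (Fin k → HolGerm × HolGerm) where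
  carrier := {c | (∀ i, dx (c i).2 = dy (c i).1 ∧
    (c i).1 * (W.fol i).coeffs.2 = (c i).2 * (W.fol i).coeffs.1) ∧ ∑ i, c i = 0}
  zero_mem' := by simp
  add_mem' := by
    rintro c d ⟨hc, hc'⟩ ⟨hd, hd'⟩
    refine ⟨fun i => ⟨?_, ?_⟩, by simp [Finset.sum_add_distrib, hc', hd']⟩
    · simp [(hc i).1, (hd i).1]
    · simp [add_mul, (hc i).2, (hd i).2]
  smul_mem' := by
    rintro r c ⟨hc, hc'⟩
    refine ⟨fun i => ⟨?_, ?_⟩, by simp [← Finset.smul_sum, hc']⟩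
    · simp [(hc i).1]
    · simp [(hc i).2]

/-- Passage from germs of forms to pairs of coefficients, where the conditions become identities in
the ring `HolGerm`. -/
theorem Web.abelianRelations_eq_map {k : ℕ} (W : Web k) :
    W.abelianRelations = W.relationCoeffs.map (formGerm.compLeft (Fin k)) := by
  ext g
  rw [Submodule.mem_map]
  constructor
  · rintro ⟨h, hs⟩
    choose η hηg hη hcl hw using h
    have hfg : formGerm.compLeft (Fin k) (fun i => PlanarWeb.coeffs (hη i)) = g :=
      funext fun i => (formGerm_coeffs (hη i)).trans (hηg i)
    refine ⟨fun i => PlanarWeb.coeffs (hη i), ⟨fun i => ⟨(closed_iff_coeffs (hη i)).1 (hcl i),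
      (wedge_iff_coeffs (hη i) (W.fol i).analyticAt).1 (hw i)⟩, ?_⟩, hfg⟩
    apply formGerm_injective
    rw [map_sum, map_zero, ← hs]
    exact Finset.sum_congr rfl fun i _ => congrFun hfg i
  · rintro ⟨c, ⟨hc, hs⟩, rfl⟩
    refine ⟨fun i => ?_, ?_⟩
    · obtain ⟨h1, h2⟩ := hc i
      obtain ⟨a, ha, h3⟩ := exists_mk (c i).1
      obtain ⟨b, hb, h4⟩ := exists_mk (c i).2
      have hη : AnalyticAt ℂ (fun z => a z • ContinuousLinearMap.fst ℂ ℂ ℂ +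
        b z • ContinuousLinearMap.snd ℂ ℂ ℂ : OneForm) 0 :=
        (ha.smul analyticAt_const).add (hb.smul analyticAt_const)
      have e : PlanarWeb.coeffs hη = c i := by
        apply formGerm_injective
        rw [formGerm_coeffs, ← formGerm_mk ha hb, h3, h4]
      refine ⟨_, ?_, hη, (closed_iff_coeffs hη).2 ?_,
        (wedge_iff_coeffs hη (W.fol i).analyticAt).2 ?_⟩
      · rw [← formGerm_coeffs hη, e]
        rfl
      · rw [e]
        exact h1
      · rw [e]
        exact h2
    · change ∑ i, formGerm (c i) = 0
      rw [← map_sum, hs, map_zero]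

theorem compLeft_injective {R M N : Type*} [Semiring R] [AddCommMonoid M] [AddCommMonoid N]
    [Module R M] [Module R N] {f : M →ₗ[R] N} (hf : Function.Injective f) (ι : Type*) :
    Function.Injective (f.compLeft ι) :=
  fun _ _ h => funext fun i => hf (congrFun h i)

/-- Abelian relations, in terms of their coefficients. -/
def Web.relationEquiv {k : ℕ} (W : Web k) : W.relationCoeffs ≃ₗ[ℂ] W.abelianRelations :=
  (Submodule.equivMapOfInjective _ (compLeft_injective formGerm_injective (Fin k))
    W.relationCoeffs).trans (LinearEquiv.ofEq _ _ W.abelianRelations_eq_map.symm)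

/-! ### Normalisation of the forms -/

namespace VectorFieldGerm

variable (X : VectorFieldGerm)

/-- The coefficients of a vector field. -/
def coeffs : HolGerm × HolGerm :=
  (HolGerm.mk (fun z => (X.toFun z).1) (analyticAt_fst.comp X.analyticAt),
    HolGerm.mk (fun z => (X.toFun z).2) (analyticAt_snd.comp X.analyticAt))

theorem foliation_coeffs (h : X.toFun 0 ≠ 0) :
    (X.foliation h).coeffs = (-X.coeffs.2, X.coeffs.1) := by
  refine Prod.ext ?_ ?_
  · simp only [FoliationGerm.coeffs, PlanarWeb.coeffs, coeffs, mk_neg, mk_eq_mk]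
    exact .of_forall fun z => by simp [foliation]
  · simp only [FoliationGerm.coeffs, PlanarWeb.coeffs, coeffs, mk_eq_mk]
    exact .of_forall fun z => by simp [foliation]

theorem ev_contract (F : FoliationGerm) :
    ev (X.coeffs.1 * F.coeffs.1 + X.coeffs.2 * F.coeffs.2) = F.form 0 (X.toFun 0) := by
  rw [clm_apply (F.form 0) (X.toFun 0)]
  rfl

variable {X}

/-- With `r = ω(X)`, this is `dr ∧ ω = r dω`: in dimension two, `i_X dω ∧ ω = -r dω`. It is the
condition for `ω / r` to be closed. -/
theorem IsInfinitesimalAutomorphismOf.coeffs_eq {F : FoliationGerm}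
    (h : X.IsInfinitesimalAutomorphismOf F) :
    F.coeffs.2 * dx (X.coeffs.1 * F.coeffs.1 + X.coeffs.2 * F.coeffs.2) -
      F.coeffs.1 * dy (X.coeffs.1 * F.coeffs.1 + X.coeffs.2 * F.coeffs.2) =
    (dx F.coeffs.2 - dy F.coeffs.1) *
      (X.coeffs.1 * F.coeffs.1 + X.coeffs.2 * F.coeffs.2) := by
  have e : X.coeffs.1 * F.coeffs.1 + X.coeffs.2 * F.coeffs.2 =
      HolGerm.mk (fun z => F.form z (X.toFun z)) (by
        have h1 := X.analyticAt
        have h2 := analyticAt_form_apply F.analyticAt (1, 0)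
        have h3 := analyticAt_form_apply F.analyticAt (0, 1)
        have := ((analyticAt_fst.comp h1).mul h2).add ((analyticAt_snd.comp h1).mul h3)
        refine this.congr (.of_forall fun z => ?_)
        exact (clm_apply (F.form z) (X.toFun z)).symm) := by
    simp only [FoliationGerm.coeffs, PlanarWeb.coeffs, coeffs, mk_mul, mk_add, mk_eq_mk]
    exact .of_forall fun z => (clm_apply (F.form z) (X.toFun z)).symm
  rw [e]
  simp only [FoliationGerm.coeffs, PlanarWeb.coeffs, pd_mk, mk_mul, mk_sub, mk_eq_mk]
  filter_upwards [h, F.analyticAt.eventually_analyticAt] with z hz ha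
  rw [wedge_eq_zero_iff] at hz
  simp only [lieDerivative, add_apply, extD_apply] at hz
  simp only [fderiv_form_apply ha]
  rw [clm_apply (F.form z) (X.toFun z)]
  have l1 (w : Plane) : fderiv ℂ F.form z (X.toFun z) w =
      (X.toFun z).1 * fderiv ℂ F.form z (1, 0) w + (X.toFun z).2 * fderiv ℂ F.form z (0, 1) w := by
    rw [← fderiv_form_apply ha, clm_apply (fderiv ℂ (fun z => F.form z w) z) (X.toFun z),
      fderiv_form_apply ha, fderiv_form_apply ha]
  rw [l1, l1, clm_apply (fderiv ℂ F.form z (1, 0)) (X.toFun z),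
    clm_apply (fderiv ℂ F.form z (0, 1)) (X.toFun z)] at hz
  linear_combination hz

/-- A form preserved by the flow of a vector field is closed once normalised. -/
theorem IsInfinitesimalAutomorphismOf.closed {F : FoliationGerm}
    (h : X.IsInfinitesimalAutomorphismOf F) {u : HolGerm}
    (hu : (X.coeffs.1 * F.coeffs.1 + X.coeffs.2 * F.coeffs.2) * u = 1) :
    dx (u * F.coeffs.2) = dy (u * F.coeffs.1) := by
  have key := h.coeffs_eq
  set r := X.coeffs.1 * F.coeffs.1 + X.coeffs.2 * F.coeffs.2
  -- The derivative of an inverse, from differentiating `r * u = 1`.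
  have hD (D : Derivation ℂ HolGerm HolGerm) : D u = -(u * u * D r) := by
    have := congrArg D hu
    rw [D.leibniz, D.map_one_eq_zero, smul_eq_mul, smul_eq_mul] at this
    linear_combination u * this - D u * hu
  rw [dx.leibniz, dy.leibniz, hD dx, hD dy]
  simp only [smul_eq_mul]
  linear_combination (-u * u) * key - u * (dx F.coeffs.2 - dy F.coeffs.1) * hu

end VectorFieldGerm

section normalize

variable {k : ℕ} {W : Web k} {X : VectorFieldGerm}

theorem exists_contract_mul_eq_one (hX : X.IsTransverse W) (i : Fin k) :
    ∃ u, (X.coeffs.1 * (W.fol i).coeffs.1 + X.coeffs.2 * (W.fol i).coeffs.2) * u = 1 := by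
  refine exists_mul_eq_one ?_
  rw [X.ev_contract]
  exact hX.transverse i

/-- The inverses of the contractions of the forms with the vector field. -/
def normalizer (hX : X.IsTransverse W) (i : Fin k) : HolGerm :=
  (exists_contract_mul_eq_one hX i).choose

theorem normalizer_spec (hX : X.IsTransverse W) (i : Fin k) :
    (X.coeffs.1 * (W.fol i).coeffs.1 + X.coeffs.2 * (W.fol i).coeffs.2) * normalizer hX i = 1 :=
  (exists_contract_mul_eq_one hX i).choose_spec

/-- The normalisation of a web with a transverse infinitesimal automorphism. -/
def Web.normalize (hX : X.IsTransverse W) (hA : X.IsInfinitesimalAutomorphism W) :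
    NormalizedWeb k where
  s := X.coeffs.1
  t := X.coeffs.2
  α i := normalizer hX i * (W.fol i).coeffs.1
  β i := normalizer hX i * (W.fol i).coeffs.2
  contract i := by
    rw [← normalizer_spec hX i]
    ring
  closed i := (hA i).closed (normalizer_spec hX i)

variable (hX : X.IsTransverse W) (hA : X.IsInfinitesimalAutomorphism W)

theorem coeffs_eq_smul_normalize (i : Fin k) :
    (W.fol i).coeffs = ((X.coeffs.1 * (W.fol i).coeffs.1 + X.coeffs.2 * (W.fol i).coeffs.2) *
      (W.normalize hX hA).α i,
      (X.coeffs.1 * (W.fol i).coeffs.1 + X.coeffs.2 * (W.fol i).coeffs.2) *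
        (W.normalize hX hA).β i) := by
  have h := normalizer_spec hX i
  refine Prod.ext ?_ ?_
  · change _ = _ * (_ * _)
    linear_combination (-(W.fol i).coeffs.1) * h
  · change _ = _ * (_ * _)
    linear_combination (-(W.fol i).coeffs.2) * h

theorem wedge_iff_normalize (i : Fin k) (a b : HolGerm) :
    a * (W.fol i).coeffs.2 = b * (W.fol i).coeffs.1 ↔
      a * (W.normalize hX hA).β i = b * (W.normalize hX hA).α i := by
  constructor
  · intro h
    change a * (normalizer hX i * _) = b * (normalizer hX i * _)
    linear_combination normalizer hX i * h
  · intro h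
    rw [coeffs_eq_smul_normalize hX hA i]
    linear_combination
      (X.coeffs.1 * (W.fol i).coeffs.1 + X.coeffs.2 * (W.fol i).coeffs.2) * h

/-- Two proportional covectors with the same value `1` on `X(0)` are equal, so they would have the
same kernel. -/
theorem normalize_distinct (i j : Fin k) (hij : i ≠ j) :
    ev ((W.normalize hX hA).α i) * ev ((W.normalize hX hA).β j) ≠
      ev ((W.normalize hX hA).α j) * ev ((W.normalize hX hA).β i) := by
  intro h
  have hi := congrArg ev ((W.normalize hX hA).contract i)
  have hj := congrArg ev ((W.normalize hX hA).contract j)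
  rw [map_add, map_mul, map_mul, map_one] at hi hj
  have hα : ev ((W.normalize hX hA).α i) = ev ((W.normalize hX hA).α j) := by
    linear_combination (ev ((W.normalize hX hA).α j)) * hi - (ev ((W.normalize hX hA).α i)) * hj +
      ev (W.normalize hX hA).t * h
  have hβ : ev ((W.normalize hX hA).β i) = ev ((W.normalize hX hA).β j) := by
    linear_combination (ev ((W.normalize hX hA).β j)) * hi - (ev ((W.normalize hX hA).β i)) * hj -
      ev (W.normalize hX hA).s * h
  refine W.distinct hij ?_
  have key (l : Fin k) (v : Plane) : v ∈ (W.fol l).tangentSpace 0 ↔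
      v.1 * ev ((W.normalize hX hA).α l) + v.2 * ev ((W.normalize hX hA).β l) = 0 := by
    have e1 : (W.fol l).form 0 (1, 0) = ev (W.fol l).coeffs.1 := rfl
    have e2 : (W.fol l).form 0 (0, 1) = ev (W.fol l).coeffs.2 := rfl
    have h0 : ev (X.coeffs.1 * (W.fol l).coeffs.1 + X.coeffs.2 * (W.fol l).coeffs.2) ≠ 0 := by
      rw [X.ev_contract]
      exact hX.transverse l
    change (W.fol l).form 0 v = 0 ↔ _
    have e3 := congrArg (fun c => ev c.1) (coeffs_eq_smul_normalize hX hA l)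
    have e4 := congrArg (fun c => ev c.2) (coeffs_eq_smul_normalize hX hA l)
    simp only [map_mul ev (_ + _)] at e3 e4
    rw [clm_apply, e1, e2, e3, e4]
    constructor
    · intro h
      refine (mul_eq_zero.1 ?_).resolve_left h0
      linear_combination h
    · intro h
      linear_combination
        ev (X.coeffs.1 * (W.fol l).coeffs.1 + X.coeffs.2 * (W.fol l).coeffs.2) * h
  ext v
  rw [key, key, hα, hβ]

/-- The relations with given coefficients with respect to the normalised forms. -/
def coeffMap (N : NormalizedWeb k) : (Fin k → HolGerm) →ₗ[ℂ] (Fin k → HolGerm × HolGerm) where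
  toFun f i := (f i * N.α i, f i * N.β i)
  map_add' f g := by
    funext i
    simp [add_mul]
  map_smul' c f := by
    funext i
    simp

theorem coeffMap_injective (N : NormalizedWeb k) : Function.Injective (coeffMap N) := by
  refine (injective_iff_map_eq_zero _).2 fun f hf => funext fun i => ?_
  have h1 : f i * N.α i = 0 := congrArg Prod.fst (congrFun hf i)
  have h2 : f i * N.β i = 0 := congrArg Prod.snd (congrFun hf i)
  change f i = 0
  linear_combination (-f i) * N.contract i + N.s * h1 + N.t * h2

/-- The coefficient of a form proportional to `ω_i` is its contraction with the vector field. -/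
theorem exists_coeff {N : NormalizedWeb k} {i : Fin k} {a b : HolGerm}
    (h : a * N.β i = b * N.α i) : (a, b) =
      ((N.s * a + N.t * b) * N.α i, (N.s * a + N.t * b) * N.β i) := by
  refine Prod.ext ?_ ?_
  · linear_combination (-a) * N.contract i + N.t * h
  · linear_combination (-b) * N.contract i - N.s * h

theorem relationCoeffs_eq_map : W.relationCoeffs =
    (W.normalize hX hA).coeffRelations.map (coeffMap (W.normalize hX hA)) := by
  set N := W.normalize hX hA with hN
  ext c
  rw [Submodule.mem_map]
  constructor
  · rintro ⟨hc, hs⟩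
    have e : coeffMap N (fun i => N.s * (c i).1 + N.t * (c i).2) = c :=
      funext fun i => (exists_coeff ((wedge_iff_normalize hX hA i _ _).1 (hc i).2)).symm
    have e1 (i : Fin k) : (N.s * (c i).1 + N.t * (c i).2) * N.α i = (c i).1 :=
      congrArg Prod.fst (congrFun e i)
    have e2 (i : Fin k) : (N.s * (c i).1 + N.t * (c i).2) * N.β i = (c i).2 :=
      congrArg Prod.snd (congrFun e i)
    refine ⟨_, ⟨fun i => ?_, ?_, ?_⟩, e⟩
    · rw [NormalizedWeb.isFirstIntegral_iff_closed, e1, e2]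
      exact (hc i).1
    · simp only [e1]
      rw [← Prod.fst_sum, hs]
      rfl
    · simp only [e2]
      rw [← Prod.snd_sum, hs]
      rfl
  · rintro ⟨f, ⟨hf, h1, h2⟩, rfl⟩
    refine ⟨fun i => ⟨NormalizedWeb.isFirstIntegral_iff_closed.1 (hf i),
      (wedge_iff_normalize hX hA i _ _).2 ?_⟩, ?_⟩
    · change f i * N.α i * N.β i = f i * N.β i * N.α i
      ring
    · refine Prod.ext ?_ ?_
      · rw [Prod.fst_sum]
        exact h1
      · rw [Prod.snd_sum]
        exact h2

/-! ### Superposition with the foliation by trajectories -/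

/-- Complete a tuple by the opposite of its sum. -/
def snocNegSum (M : Type*) [AddCommGroup M] [Module ℂ M] (k : ℕ) :
    (Fin k → M) →ₗ[ℂ] (Fin (k + 1) → M) where
  toFun c := Fin.snoc (α := fun _ => M) c (-∑ i, c i)
  map_add' c d := by
    funext i
    induction i using Fin.lastCases with
    | last => simp [Finset.sum_add_distrib, add_comm]
    | cast i => simp
  map_smul' r c := by
    funext i
    induction i using Fin.lastCases with
    | last => simp [Finset.smul_sum]
    | cast i => simp

theorem snocNegSum_injective (M : Type*) [AddCommGroup M] [Module ℂ M] (k : ℕ) :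
    Function.Injective (snocNegSum M k) := by
  intro c d h
  funext i
  simpa [snocNegSum] using congrFun h i.castSucc

/-- The last form must be minus the sum of the others, so it is closed for free; its tangency to the
trajectories means that it is killed by `X`, which is the equation `∑ f_i = 0`. -/
theorem superpose_relationCoeffs_eq_map : (W.superposeVectorField X hX).relationCoeffs =
    (W.normalize hX hA).sumZeroIntegrals.map
      ((snocNegSum (HolGerm × HolGerm) k).comp (coeffMap (W.normalize hX hA))) := by
  set N := W.normalize hX hA with hN
  have hcast (i : Fin k) : (W.superposeVectorField X hX).fol i.castSucc = W.fol i := by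
    simp [Web.superposeVectorField, Web.superpose]
  have hlast : ((W.superposeVectorField X hX).fol (Fin.last k)).coeffs = (-N.t, N.s) := by
    rw [show N.t = X.coeffs.2 from rfl, show N.s = X.coeffs.1 from rfl,
      ← X.foliation_coeffs hX.regular]
    simp [Web.superposeVectorField, Web.superpose]
  ext c
  rw [Submodule.mem_map]
  constructor
  · rintro ⟨hc, hs⟩
    rw [Fin.sum_univ_castSucc] at hs
    have e (i : Fin k) : c i.castSucc = ((N.s * (c i.castSucc).1 + N.t * (c i.castSucc).2) * N.α i,
        (N.s * (c i.castSucc).1 + N.t * (c i.castSucc).2) * N.β i) := by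
      refine exists_coeff ((wedge_iff_normalize hX hA i _ _).1 ?_)
      have := (hc i.castSucc).2
      rwa [hcast] at this
    have e' : coeffMap N (fun i => N.s * (c i.castSucc).1 + N.t * (c i.castSucc).2) =
        fun i => c i.castSucc := funext fun i => (e i).symm
    refine ⟨fun i => N.s * (c i.castSucc).1 + N.t * (c i.castSucc).2, ⟨fun i => ?_, ?_⟩, ?_⟩
    · rw [NormalizedWeb.isFirstIntegral_iff_closed]
      have := (hc i.castSucc).1
      rwa [e i] at this
    · have h1 := congrArg Prod.fst hs
      have h2 := congrArg Prod.snd hs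
      rw [Prod.fst_add, Prod.fst_sum, Prod.fst_zero] at h1
      rw [Prod.snd_add, Prod.snd_sum, Prod.snd_zero] at h2
      have h3 := (hc (Fin.last k)).2
      rw [hlast] at h3
      rw [Finset.sum_add_distrib, ← Finset.mul_sum, ← Finset.mul_sum]
      -- Contraction of the relation with `X`; `h3` removes the contribution of the last form.
      linear_combination N.s * h1 + N.t * h2 - h3
    · rw [LinearMap.comp_apply, e']
      funext i
      induction i using Fin.lastCases with
      | last =>
        simp only [snocNegSum, LinearMap.coe_mk, AddHom.coe_mk, Fin.snoc_last]
        exact (eq_neg_of_add_eq_zero_right hs).symm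
      | cast i => simp [snocNegSum]
  · rintro ⟨f, ⟨hf, h⟩, rfl⟩
    have hcl (i : Fin k) : dx (f i * N.β i) = dy (f i * N.α i) :=
      NormalizedWeb.isFirstIntegral_iff_closed.1 (hf i)
    refine ⟨fun i => ?_, ?_⟩
    · induction i using Fin.lastCases with
      | last =>
        have e : ((snocNegSum (HolGerm × HolGerm) k).comp (coeffMap N)) f (Fin.last k) =
            (-∑ i, f i * N.α i, -∑ i, f i * N.β i) := by
          simp only [snocNegSum, LinearMap.comp_apply, LinearMap.coe_mk, AddHom.coe_mk,
            Fin.snoc_last]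
          refine Prod.ext ?_ ?_
          · rw [Prod.fst_neg, Prod.fst_sum]
            rfl
          · rw [Prod.snd_neg, Prod.snd_sum]
            rfl
        rw [e, hlast]
        refine ⟨?_, ?_⟩
        · simp only [map_neg, map_sum, hcl]
        · have : ∑ i, f i = N.s * (∑ i, f i * N.α i) + N.t * ∑ i, f i * N.β i := by
            rw [Finset.mul_sum, Finset.mul_sum, ← Finset.sum_add_distrib]
            refine Finset.sum_congr rfl fun i _ => ?_
            linear_combination (-f i) * N.contract i
          rw [h] at this
          linear_combination this
      | cast i =>
        have e : ((snocNegSum (HolGerm × HolGerm) k).comp (coeffMap N)) f i.castSucc =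
            (f i * N.α i, f i * N.β i) := by
          simp [snocNegSum, coeffMap]
        rw [e, hcast]
        refine ⟨hcl i, (wedge_iff_normalize hX hA i _ _).2 ?_⟩
        change f i * N.α i * N.β i = f i * N.β i * N.α i
        ring
    · rw [Fin.sum_univ_castSucc]
      simp [snocNegSum]

/-- The abelian relations of a web with a transverse infinitesimal automorphism. -/
def coeffEquiv : (W.normalize hX hA).coeffRelations ≃ₗ[ℂ] W.abelianRelations :=
  ((Submodule.equivMapOfInjective _ (coeffMap_injective _) _).trans
    (LinearEquiv.ofEq _ _ (relationCoeffs_eq_map hX hA).symm)).trans W.relationEquiv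

/-- The abelian relations of its superposition with the foliation by trajectories. -/
def superposeCoeffEquiv : (W.normalize hX hA).sumZeroIntegrals ≃ₗ[ℂ]
    (W.superposeVectorField X hX).abelianRelations :=
  ((Submodule.equivMapOfInjective
    ((snocNegSum (HolGerm × HolGerm) k).comp (coeffMap (W.normalize hX hA)))
    ((snocNegSum_injective _ k).comp (coeffMap_injective (W.normalize hX hA))) _).trans
    (LinearEquiv.ofEq _ _ (superpose_relationCoeffs_eq_map hX hA).symm)).trans
    (W.superposeVectorField X hX).relationEquiv

end normalize

end PlanarWeb

end

/-! ### The rank formula -/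

theorem theorem1 (k : ℕ) (hk : 1 ≤ k) (W : PlanarWeb.Web k) (X : PlanarWeb.VectorFieldGerm)
    (hX : X.IsTransverse W) (hA : X.IsInfinitesimalAutomorphism W) :
    Module.Finite ℂ W.abelianRelations ∧
    Module.Finite ℂ (W.superposeVectorField X hX).abelianRelations ∧
    (W.superposeVectorField X hX).rank = W.rank + (k - 1) ∧
    (W.HasMaximalRank ↔ (W.superposeVectorField X hX).HasMaximalRank) := by
  have h1 : Module.Finite ℂ (W.normalize hX hA).coeffRelations :=
    PlanarWeb.NormalizedWeb.finite_coeffRelations (PlanarWeb.normalize_distinct hX hA)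
  have h2 := (W.normalize hX hA).finite_sumZeroIntegrals
  have h3 : (W.superposeVectorField X hX).rank = W.rank + (k - 1) := by
    unfold PlanarWeb.Web.rank
    rw [← (PlanarWeb.superposeCoeffEquiv hX hA).finrank_eq,
      ← (PlanarWeb.coeffEquiv hX hA).finrank_eq]
    exact (W.normalize hX hA).finrank_sumZeroIntegrals hk
  refine ⟨.equiv (PlanarWeb.coeffEquiv hX hA), .equiv (PlanarWeb.superposeCoeffEquiv hX hA), h3, ?_⟩
  unfold PlanarWeb.Web.HasMaximalRank
  rw [h3]
  -- The maximal ranks for `k + 1` and `k` differ by `k(k-1)/2 - (k-1)(k-2)/2 = k - 1`; `hk` makes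
  -- the natural subtraction exact.
  push_cast [hk]
  constructor <;> intro h <;> linear_combination h
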